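/- Let $K$ be a field and let $n_1<n_2<n_3<n_4$ be positive integers with $\gcd(n_1,n_2,n_3,n_4)=1$. Let $C$ be the monomial curve in $\mathbb{A}^4(K)$ parametrized by $x_i=t^{n_i}$ $(1\le i\le 4)$, and let $I(C)$ be its toric ideal, that is, the kernel of the $K$-algebra homomorphism $K[x_1,x_2,x_3,x_4]\to K[t]$ with $x_i\mapsto t^{n_i}$. The tangent cone of $C$ at the origin has coordinate ring $K[x_1,x_2,x_3,x_4]/I(C)_*$, where $I(C)_*$ is the ideal generated by the homogeneous summands of least degree of the elements of $I(C)$; we say that $C$ has Cohen–Macaulay tangent cone at the origin if this ring is Cohen–Macaulay. Suppose that $I(C)$ is generated by the five binomials $$x_1^{a_1}-x_2^{a_{12}}x_3^{a_{13}},\quad x_2^{a_2}-x_1^{a_{21}}x_4^{a_{24}},\quad x_3^{a_3}-x_2^{a_{32}}x_4^{a_{34}},\quad x_4^{a_4}-x_1^{a_{41}}x_3^{a_{43}},\quad x_1^{a_{41}}x_2^{a_{32}}-x_3^{a_{13}}x_4^{a_{24}},$$ where $0<a_{ij}<a_j$ for all the exponents $a_{ij}$ that occur (this is one of the six permuted forms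 of Bresinsky's generators for a non-complete intersection Gorenstein monomial curve), and suppose that $a_{24}\le a_{34}$. Then $C$ has Cohen–Macaulay tangent cone at the origin if and only if 1. $a_2\le a_{21}+a_{24}$, and 2. either $a_{32}<a_{12}$ and $a_3+a_{13}\le a_{41}+2a_{32}+a_{34}-a_{24}$, or $a_{12}\le a_{32}$ and $a_3+a_{13}\le a_1+a_{32}-a_{12}+a_{34}$. -/

import Mathlib

open MvPolynomial

noncomputable section

namespace MonomialCurve

/-- The toric ideal `I(C)` of the affine monomial curve `x_i = t ^ (n i)`: the kernel of the
`K`-algebra homomorphism `K[x_1, …, x_d] → K[t]` sending `x_i` to `t ^ (n i)`. -/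
def toricIdeal (K : Type*) [Field K] {d : ℕ} (n : Fin d → ℕ) : Ideal (MvPolynomial (Fin d) K) :=
  RingHom.ker (MvPolynomial.aeval (fun i => (Polynomial.X : Polynomial K) ^ n i))

/-- The homogeneous summand `f_*` of least degree of a polynomial `f` (it is `0` for `f = 0`). -/
def leastForm {K : Type*} [Field K] {d : ℕ} (f : MvPolynomial (Fin d) K) :
    MvPolynomial (Fin d) K :=
  homogeneousComponent (sInf {k : ℕ | homogeneousComponent k f ≠ 0}) f

/-- The ideal `I_*` generated by the forms `f_*` for `f ∈ I`. -/
def leastFormIdeal {K : Type*} [Field K] {d : ℕ} (I : Ideal (MvPolynomial (Fin d) K)) :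
    Ideal (MvPolynomial (Fin d) K) :=
  Ideal.span (leastForm '' (I : Set (MvPolynomial (Fin d) K)))

/-- The coordinate ring `K[x_1, …, x_d] / I(C)_*` of the tangent cone at the origin of the
monomial curve `x_i = t ^ (n i)`. -/
abbrev TangentConeRing (K : Type*) [Field K] {d : ℕ} (n : Fin d → ℕ) : Type _ :=
  MvPolynomial (Fin d) K ⧸ leastFormIdeal (toricIdeal K n)

/-- A Noetherian local ring is Cohen–Macaulay if its depth equals its Krull dimension, i.e. if its
maximal ideal contains a regular sequence whose length is the dimension of the ring. -/
def IsCohenMacaulayLocalRing (R : Type*) [CommRing R] [IsLocalRing R] : Prop :=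
  IsNoetherianRing R ∧
    ∃ rs : List R, (∀ r ∈ rs, r ∈ IsLocalRing.maximalIdeal R) ∧
      RingTheory.Sequence.IsRegular R rs ∧ ((rs.length : ℕ) : WithBot ℕ∞) = ringKrullDim R

/-- A Noetherian ring is Cohen–Macaulay if all its localizations at maximal ideals are
Cohen–Macaulay local rings. -/
def IsCohenMacaulayRing (R : Type*) [CommRing R] : Prop :=
  IsNoetherianRing R ∧
    ∀ (m : Ideal R) [m.IsMaximal], IsCohenMacaulayLocalRing (Localization.AtPrime m)

/-- The monomial curve `x_i = t ^ (n i)` has Cohen–Macaulay tangent cone at the origin. -/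
def HasCohenMacaulayTangentCone (K : Type*) [Field K] {d : ℕ} (n : Fin d → ℕ) : Prop :=
  IsCohenMacaulayRing (TangentConeRing K n)

/-- The five binomials generating the toric ideal of a non-complete intersection Gorenstein
monomial curve, with the variables arranged as `x_1 ^ a₁ - x_2 ^ a₁₂ * x_3 ^ a₁₃`,
`x_2 ^ a₂ - x_1 ^ a₂₁ * x_4 ^ a₂₄`, and so on; the variables `x_1, x_2, x_3, x_4` are
`X 0, X 1, X 2, X 3`. -/
def gorensteinBinomials (K : Type*) [Field K]
    (a₁ a₂ a₃ a₄ a₁₂ a₁₃ a₂₁ a₂₄ a₃₂ a₃₄ a₄₁ a₄₃ : ℕ) : Set (MvPolynomial (Fin 4) K) :=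
  {X 0 ^ a₁ - X 1 ^ a₁₂ * X 2 ^ a₁₃,
   X 1 ^ a₂ - X 0 ^ a₂₁ * X 3 ^ a₂₄,
   X 2 ^ a₃ - X 1 ^ a₃₂ * X 3 ^ a₃₄,
   X 3 ^ a₄ - X 0 ^ a₄₁ * X 2 ^ a₄₃,
   X 0 ^ a₄₁ * X 1 ^ a₃₂ - X 2 ^ a₁₃ * X 3 ^ a₂₄}

end MonomialCurve

end

/-! Group the monomials by weight, that is, by their image in `K[t]`. Modulo `I(C)_*`, monomials of
greatest degree in their weight class become identified with one another, and all other monomials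
vanish. So the tangent cone ring has a basis indexed by the semigroup, and
`mem_leastFormIdeal_toricIdeal_iff` presents `I(C)_*` as the kernel of an explicit linear map into
`K[T]`.

As `n₁` is smallest, all variables except `x₁` are nilpotent in this ring, so it is `K[x₁]` up to
nilpotents and has dimension at most one. Cohen–Macaulayness then means that `x₁` is a
nonzerodivisor: multiplying by `x₁` must preserve greatest degree
(`hasCohenMacaulayTangentCone_iff`). Equivalently, a monomial whose weight class meets `(x₁)` has a
partner in `(x₁)` of at least its degree.

The five binomials reduce this to finitely many monomials. Any property preserved by the five
exchanges is constant on weight classes (`MoveClosed.iff_of_weight_eq`). One such property leaves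
only the multiples of `x₂^a₂`, `x₄^a₄`, `x₃^(a₃+a₁₃)`, `x₂^a₁₂ x₃^a₁₃` and `x₃^a₁₃ x₄^a₂₄` to check.
Three of these have partners because `n₁ < n₂ < n₃ < n₄`; `x₂^a₂` gives condition 1 and
`x₃^(a₃+a₁₃)` gives condition 2, read off from their complete weight classes. -/

noncomputable section

namespace MonomialCurve

/-! ### The ideal of least forms as the kernel of a linear map -/

section InitialMap

variable {K : Type*} [Field K] {d : ℕ} {n : Fin d → ℕ}

/-- The exponent vector `u` has the greatest total degree among the exponent vectors of the same
weight. -/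
def IsMaxFactorization (n : Fin d → ℕ) (u : Fin d →₀ ℕ) : Prop :=
  ∀ v, Finsupp.weight n v = Finsupp.weight n u → v.degree ≤ u.degree

lemma IsMaxFactorization.of_add {u c : Fin d →₀ ℕ} (h : IsMaxFactorization n (u + c)) :
    IsMaxFactorization n u := fun v hv => by
  have := h (v + c) (by simp only [map_add, hv])
  simp only [map_add] at this
  omega

lemma IsMaxFactorization.of_add_left {u c : Fin d →₀ ℕ} (h : IsMaxFactorization n (u + c)) :
    IsMaxFactorization n c := by
  rw [add_comm] at h
  exact h.of_add

lemma IsMaxFactorization.congr {u v : Fin d →₀ ℕ} (h : IsMaxFactorization n u)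
    (hw : Finsupp.weight n v = Finsupp.weight n u) (hd : v.degree = u.degree) :
    IsMaxFactorization n v := fun w h' => by
  rw [hd]
  exact h w (h'.trans hw)

lemma IsMaxFactorization.degree_eq {u v : Fin d →₀ ℕ} (hu : IsMaxFactorization n u)
    (hv : IsMaxFactorization n v) (hw : Finsupp.weight n v = Finsupp.weight n u) :
    v.degree = u.degree :=
  le_antisymm (hu v hw) (hv u hw.symm)

lemma degree_mul_le_weight {k : ℕ} (hk : ∀ i, k ≤ n i) (u : Fin d →₀ ℕ) :
    u.degree * k ≤ Finsupp.weight n u := by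
  rw [Finsupp.degree_eq_sum, Finsupp.weight_eq_sum, Finset.sum_mul]
  exact Finset.sum_le_sum fun i _ => by simpa using Nat.mul_le_mul_left _ (hk i)

lemma degree_le_weight (hn : ∀ i, 0 < n i) (u : Fin d →₀ ℕ) :
    u.degree ≤ Finsupp.weight n u := by
  simpa using degree_mul_le_weight hn u

lemma exists_isMaxFactorization (hn : ∀ i, 0 < n i) (u : Fin d →₀ ℕ) :
    ∃ v, Finsupp.weight n v = Finsupp.weight n u ∧ IsMaxFactorization n v := by
  have hb : BddAbove {k | ∃ v : Fin d →₀ ℕ, Finsupp.weight n v = Finsupp.weight n u ∧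
      v.degree = k} := ⟨Finsupp.weight n u, by
    rintro k ⟨v, hv, rfl⟩
    exact hv ▸ degree_le_weight hn v⟩
  have hne : {k | ∃ v : Fin d →₀ ℕ, Finsupp.weight n v = Finsupp.weight n u ∧
      v.degree = k}.Nonempty := ⟨u.degree, u, rfl, rfl⟩
  obtain ⟨v, hv, hk⟩ := Nat.sSup_mem hne hb
  exact ⟨v, hv, fun w hw => hk ▸ le_csSup hb ⟨w, hw.trans hv, rfl⟩⟩

open Classical in
/-- The linear map sending a monomial of weight `w` to `T ^ w` if its exponent vector is a
factorization of greatest degree, and to `0` otherwise. -/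
def initialMap (K : Type*) [Field K] {d : ℕ} (n : Fin d → ℕ) :
    MvPolynomial (Fin d) K →ₗ[K] Polynomial K :=
  (basisMonomials (Fin d) K).constr K fun u =>
    if IsMaxFactorization n u then Polynomial.X ^ Finsupp.weight n u else 0

lemma initialMap_monomial_of_isMax {u : Fin d →₀ ℕ} (hu : IsMaxFactorization n u) (c : K) :
    initialMap K n (monomial u c) = Polynomial.monomial (Finsupp.weight n u) c := by
  have : monomial u c = c • basisMonomials (Fin d) K u := by simp [smul_monomial]
  rw [this, map_smul, initialMap, Module.Basis.constr_basis, if_pos hu,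
    ← Polynomial.monomial_one_right_eq_X_pow, Polynomial.smul_monomial, smul_eq_mul, mul_one]

lemma initialMap_monomial_of_not_isMax {u : Fin d →₀ ℕ} (hu : ¬ IsMaxFactorization n u) (c : K) :
    initialMap K n (monomial u c) = 0 := by
  have : monomial u c = c • basisMonomials (Fin d) K u := by simp [smul_monomial]
  rw [this, map_smul, initialMap, Module.Basis.constr_basis, if_neg hu, smul_zero]

open Classical in
/-- Multiplication by the monomial of exponent vector `c` on the image of `initialMap`. -/
def shiftMap (K : Type*) [Field K] {d : ℕ} (n : Fin d → ℕ) (c : Fin d →₀ ℕ) :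
    Polynomial K →ₗ[K] Polynomial K :=
  (Polynomial.basisMonomials K).constr K fun s =>
    if ∃ u, Finsupp.weight n u = s ∧ IsMaxFactorization n (u + c) then
      Polynomial.X ^ (s + Finsupp.weight n c) else 0

open Classical in
lemma shiftMap_monomial (c : Fin d →₀ ℕ) (s : ℕ) (a : K) :
    shiftMap K n c (Polynomial.monomial s a) =
      if ∃ u, Finsupp.weight n u = s ∧ IsMaxFactorization n (u + c) then
        Polynomial.monomial (s + Finsupp.weight n c) a else 0 := by
  have : Polynomial.monomial s a = a • Polynomial.basisMonomials K s := by
    simp [Polynomial.smul_monomial]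
  rw [this, map_smul, shiftMap, Module.Basis.constr_basis]
  split_ifs
  · rw [← Polynomial.monomial_one_right_eq_X_pow, Polynomial.smul_monomial, smul_eq_mul, mul_one]
  · rw [smul_zero]

/-- Among maximal `u` of a given weight the degree is constant, so maximality of `u + c` depends
only on that weight. Hence the kernel of `initialMap` is an ideal. -/
lemma initialMap_monomial_mul (c : Fin d →₀ ℕ) (f : MvPolynomial (Fin d) K) :
    initialMap K n (monomial c 1 * f) = shiftMap K n c (initialMap K n f) := by
  induction f using MvPolynomial.induction_on' with
  | add p q hp hq => rw [mul_add, map_add, hp, hq, map_add, map_add]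
  | monomial u a =>
    rw [monomial_mul, one_mul, add_comm c u]
    by_cases h : IsMaxFactorization n (u + c)
    · rw [initialMap_monomial_of_isMax h, initialMap_monomial_of_isMax h.of_add,
        shiftMap_monomial, if_pos ⟨u, rfl, h⟩, map_add]
    · rw [initialMap_monomial_of_not_isMax h]
      by_cases hu : IsMaxFactorization n u
      · rw [initialMap_monomial_of_isMax hu, shiftMap_monomial, if_neg]
        rintro ⟨v, hv, hvc⟩
        refine h (hvc.congr (by simp only [map_add, hv]) ?_)
        simp only [map_add, hu.degree_eq hvc.of_add hv]
      · rw [initialMap_monomial_of_not_isMax hu, map_zero]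

lemma initialMap_mul_eq_zero (g : MvPolynomial (Fin d) K) {f : MvPolynomial (Fin d) K}
    (hf : initialMap K n f = 0) : initialMap K n (g * f) = 0 := by
  induction g using MvPolynomial.induction_on' with
  | add p q hp hq => rw [add_mul, map_add, hp, hq, add_zero]
  | monomial u a =>
    have : monomial u a * f = a • (monomial u 1 * f) := by
      rw [← smul_mul_assoc, smul_monomial, smul_eq_mul, mul_one]
    rw [this, map_smul, initialMap_monomial_mul, hf, map_zero, smul_zero]

lemma aeval_monomial_X_pow (u : Fin d →₀ ℕ) (a : K) :
    aeval (fun i => (Polynomial.X : Polynomial K) ^ n i) (monomial u a) =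
      Polynomial.monomial (Finsupp.weight n u) a := by
  rw [aeval_monomial, Finsupp.prod_fintype _ _ (by simp), Finsupp.weight_eq_sum,
    ← Polynomial.C_mul_X_pow_eq_monomial, ← Finset.prod_pow_eq_pow_sum]
  congr 1
  exact Finset.prod_congr rfl fun i _ => by rw [← pow_mul, smul_eq_mul, mul_comm]

lemma monomial_sub_monomial_mem_toricIdeal {u v : Fin d →₀ ℕ}
    (h : Finsupp.weight n u = Finsupp.weight n v) :
    monomial u (1 : K) - monomial v 1 ∈ toricIdeal K n := by
  rw [toricIdeal, RingHom.mem_ker, map_sub]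
  erw [aeval_monomial_X_pow, aeval_monomial_X_pow]
  rw [h, sub_self]

lemma weight_eq_of_monomial_sub_monomial_mem {u v : Fin d →₀ ℕ}
    (h : monomial u (1 : K) - monomial v 1 ∈ toricIdeal K n) :
    Finsupp.weight n u = Finsupp.weight n v := by
  rw [toricIdeal, RingHom.mem_ker, map_sub] at h
  erw [aeval_monomial_X_pow, aeval_monomial_X_pow] at h
  have := congrArg Polynomial.natDegree (sub_eq_zero.1 h)
  rwa [Polynomial.natDegree_monomial_eq _ one_ne_zero,
    Polynomial.natDegree_monomial_eq _ one_ne_zero] at this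

open Classical in
lemma coeff_initialMap (f : MvPolynomial (Fin d) K) (s : ℕ) :
    (initialMap K n f).coeff s =
      ∑ u ∈ f.support with IsMaxFactorization n u ∧ Finsupp.weight n u = s, coeff u f := by
  conv_lhs => rw [f.as_sum]
  rw [map_sum, Polynomial.finsetSum_coeff, Finset.sum_filter]
  refine Finset.sum_congr rfl fun u _ => ?_
  by_cases h : IsMaxFactorization n u
  · simp [initialMap_monomial_of_isMax h, Polynomial.coeff_monomial, h]
  · simp [initialMap_monomial_of_not_isMax h, h]

lemma sum_coeff_eq_zero_of_mem_toricIdeal {f : MvPolynomial (Fin d) K} (hf : f ∈ toricIdeal K n)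
    (s : ℕ) : ∑ u ∈ f.support with Finsupp.weight n u = s, coeff u f = 0 := by
  have h : aeval (fun i => (Polynomial.X : Polynomial K) ^ n i) f = 0 := hf
  rw [f.as_sum, map_sum] at h
  have h' := congrArg (fun p => Polynomial.coeff p s) h
  simp only [aeval_monomial_X_pow, Polynomial.finsetSum_coeff, Polynomial.coeff_monomial,
    Polynomial.coeff_zero] at h'
  rw [Finset.sum_filter]
  exact h'

lemma initialMap_leastForm {f : MvPolynomial (Fin d) K} (hf : f ∈ toricIdeal K n) :
    initialMap K n (leastForm f) = 0 := by
  classical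
  ext s
  set k := sInf {k : ℕ | homogeneousComponent k f ≠ 0} with hk
  have hmin : ∀ v ∈ f.support, k ≤ v.degree := fun v hv => by
    refine Nat.sInf_le ?_
    intro h
    have := congrArg (coeff v) h
    rw [coeff_homogeneousComponent, if_pos rfl, coeff_zero] at this
    exact mem_support_iff.1 hv this
  have hcoeff : ∀ v, coeff v (leastForm f) = if v.degree = k then coeff v f else 0 := fun v => by
    rw [leastForm, coeff_homogeneousComponent]
  rw [coeff_initialMap, Polynomial.coeff_zero]
  -- If a maximal factorization of weight `s` has the least degree `k`, every term of `f` of weight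
  -- `s` has degree exactly `k`, so the sum is the full coefficient sum of that weight, which
  -- vanishes. Otherwise `f_*` has no maximal term of weight `s`.
  by_cases hs : ∃ u, IsMaxFactorization n u ∧ Finsupp.weight n u = s ∧ u.degree = k
  · obtain ⟨u, hu, rfl, hdu⟩ := hs
    rw [← sum_coeff_eq_zero_of_mem_toricIdeal hf (Finsupp.weight n u)]
    refine Finset.sum_congr_of_eq_on_inter ?_ ?_ ?_
    · intro v hv hv'
      simp only [Finset.mem_filter, mem_support_iff, hcoeff] at hv hv'
      exfalso
      refine hv' ⟨?_, hv.2.2⟩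
      intro h0
      simp [h0] at hv
    · intro v hv hv'
      simp only [Finset.mem_filter] at hv hv'
      have hdv : v.degree = k := le_antisymm (hdu ▸ hu v hv.2) (hmin v hv.1)
      have hvm : IsMaxFactorization n v := hu.congr hv.2 (hdv.trans hdu.symm)
      by_contra h0
      refine hv' ⟨mem_support_iff.2 ?_, hvm, hv.2⟩
      rw [hcoeff, if_pos hdv]
      exact h0
    · intro v hv hv'
      simp only [Finset.mem_filter] at hv hv'
      have hdv : v.degree = k := le_antisymm (hdu ▸ hu v hv'.2) (hmin v hv'.1)
      rw [hcoeff, if_pos hdv]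
  · refine Finset.sum_eq_zero fun v hv => ?_
    simp only [Finset.mem_filter] at hv
    rw [hcoeff, if_neg fun h => hs ⟨v, hv.2.1, hv.2.2, h⟩]

lemma initialMap_eq_zero_of_mem {f : MvPolynomial (Fin d) K}
    (hf : f ∈ leastFormIdeal (toricIdeal K n)) : initialMap K n f = 0 := by
  refine Submodule.span_induction ?_ (map_zero _) ?_ ?_ hf
  · rintro _ ⟨g, hg, rfl⟩
    exact initialMap_leastForm hg
  · intro x y _ _ hx hy
    rw [map_add, hx, hy, add_zero]
  · intro a x _ hx
    exact initialMap_mul_eq_zero a hx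

lemma leastForm_of_isHomogeneous {f : MvPolynomial (Fin d) K} {k : ℕ} (hf : f.IsHomogeneous k) :
    leastForm f = f := by
  rcases eq_or_ne f 0 with rfl | h0
  · simp [leastForm]
  have : {j : ℕ | homogeneousComponent j f ≠ 0} = {k} := by
    ext j
    have := homogeneousComponent_of_mem (m := j) ((mem_homogeneousSubmodule k f).2 hf)
    simp only [Set.mem_ofPred_eq, this, Set.mem_singleton_iff, ne_eq, ite_eq_right_iff, h0,
      imp_false, not_not]
  rw [leastForm, this, csInf_singleton]
  exact homogeneousComponent_eq_self hf

lemma leastForm_monomial_sub_monomial {u v : Fin d →₀ ℕ} (h : u.degree < v.degree) :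
    leastForm (monomial u (1 : K) - monomial v 1) = monomial u 1 := by
  have hc : ∀ j, homogeneousComponent j (monomial u (1 : K) - monomial v 1) =
      (if j = u.degree then monomial u 1 else 0) - (if j = v.degree then monomial v 1 else 0) := by
    intro j
    rw [map_sub, homogeneousComponent_of_mem ((mem_homogeneousSubmodule u.degree _).2
      (isHomogeneous_monomial _ rfl)), homogeneousComponent_of_mem
      ((mem_homogeneousSubmodule v.degree _).2 (isHomogeneous_monomial _ rfl))]
  have : IsLeast {j : ℕ | homogeneousComponent j (monomial u (1 : K) - monomial v 1) ≠ 0}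
      u.degree := by
    constructor
    · simp [hc, h.ne]
    · intro j hj
      by_contra! hlt
      refine hj ?_
      rw [hc, if_neg hlt.ne, if_neg (hlt.trans h).ne, sub_zero]
  rw [leastForm, this.csInf_eq, hc, if_pos rfl, if_neg h.ne, sub_zero]

lemma monomial_mem_leastFormIdeal {u : Fin d →₀ ℕ} (hu : ¬ IsMaxFactorization n u) :
    monomial u (1 : K) ∈ leastFormIdeal (toricIdeal K n) := by
  simp only [IsMaxFactorization, not_forall, not_le] at hu
  obtain ⟨v, hw, hd⟩ := hu
  rw [← leastForm_monomial_sub_monomial hd]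
  exact Ideal.subset_span ⟨_, monomial_sub_monomial_mem_toricIdeal hw.symm, rfl⟩

lemma monomial_sub_monomial_mem_leastFormIdeal {u v : Fin d →₀ ℕ}
    (hw : Finsupp.weight n u = Finsupp.weight n v) (hd : u.degree = v.degree) :
    monomial u (1 : K) - monomial v 1 ∈ leastFormIdeal (toricIdeal K n) := by
  rw [← leastForm_of_isHomogeneous ((isHomogeneous_monomial (1 : K) rfl).sub
    (isHomogeneous_monomial (1 : K) hd.symm))]
  exact Ideal.subset_span ⟨_, monomial_sub_monomial_mem_toricIdeal hw, rfl⟩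

open Classical in
/-- A linear map from the image of `initialMap` to the tangent cone ring that inverts
`initialMap`. -/
def initialSection (K : Type*) [Field K] {d : ℕ} (n : Fin d → ℕ) :
    Polynomial K →ₗ[K] TangentConeRing K n :=
  (Polynomial.basisMonomials K).constr K fun s =>
    if h : ∃ u, IsMaxFactorization n u ∧ Finsupp.weight n u = s then
      Ideal.Quotient.mk _ (monomial h.choose 1) else 0

lemma initialSection_initialMap (f : MvPolynomial (Fin d) K) :
    initialSection K n (initialMap K n f) = Ideal.Quotient.mk _ f := by
  induction f using MvPolynomial.induction_on' with
  | add p q hp hq => rw [map_add, map_add, hp, hq, map_add]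
  | monomial u a =>
    have ha : monomial u a = a • monomial u (1 : K) := by simp [smul_monomial]
    have hmk : (Ideal.Quotient.mk (leastFormIdeal (toricIdeal K n))) (a • monomial u (1 : K)) =
        a • Ideal.Quotient.mk (leastFormIdeal (toricIdeal K n)) (monomial u (1 : K)) := rfl
    rw [ha, map_smul, map_smul, hmk]
    congr 1
    by_cases h : IsMaxFactorization n u
    · have hex : ∃ v, IsMaxFactorization n v ∧ Finsupp.weight n v = Finsupp.weight n u :=
        ⟨u, h, rfl⟩
      have := hex.choose_spec
      have hb : Polynomial.monomial (Finsupp.weight n u) (1 : K) =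
        Polynomial.basisMonomials K (Finsupp.weight n u) := by simp
      rw [initialMap_monomial_of_isMax h, hb, initialSection, Module.Basis.constr_basis,
        dif_pos hex, Ideal.Quotient.eq]
      exact monomial_sub_monomial_mem_leastFormIdeal this.2 (h.degree_eq this.1 this.2)
    · rw [initialMap_monomial_of_not_isMax h, map_zero, eq_comm, Ideal.Quotient.eq_zero_iff_mem]
      exact monomial_mem_leastFormIdeal h

/-- For the converse, `initialSection` recovers the class of `f` from its image: non-maximal
monomials and differences of maximal monomials of equal weight are themselves least forms of
binomials in the toric ideal. -/
theorem mem_leastFormIdeal_toricIdeal_iff {f : MvPolynomial (Fin d) K} :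
    f ∈ leastFormIdeal (toricIdeal K n) ↔ initialMap K n f = 0 := by
  refine ⟨initialMap_eq_zero_of_mem, fun h => ?_⟩
  rw [← Ideal.Quotient.eq_zero_iff_mem, ← initialSection_initialMap, h, map_zero]

end InitialMap

/-! ### Cohen–Macaulayness as regularity of the variable of least weight -/

section CohenMacaulay

variable {K : Type*} [Field K] {d : ℕ} {n : Fin d → ℕ} {i₀ : Fin d}

lemma isMaxFactorization_single (h₀ : 0 < n i₀) (hlt : ∀ i, i ≠ i₀ → n i₀ < n i) (k : ℕ) :
    IsMaxFactorization n (Finsupp.single i₀ k) := fun v hv => by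
  have hle : ∀ i, n i₀ ≤ n i := fun i => by
    rcases eq_or_ne i i₀ with rfl | h
    exacts [le_rfl, (hlt i h).le]
  have := degree_mul_le_weight hle v
  rw [hv, Finsupp.weight_single, smul_eq_mul] at this
  rw [Finsupp.degree_single]
  exact Nat.le_of_mul_le_mul_right this h₀

/-- The powers `x_i ^ n i₀` and `x_{i₀} ^ n i` have the same weight, and the second has larger
degree. -/
lemma not_isMaxFactorization_single (hlt : ∀ i, i ≠ i₀ → n i₀ < n i) {i : Fin d} (hi : i ≠ i₀) :
    ¬ IsMaxFactorization n (Finsupp.single i (n i₀)) := fun h => by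
  have := h (Finsupp.single i₀ (n i)) (by
    simp only [Finsupp.weight_single, smul_eq_mul, mul_comm])
  rw [Finsupp.degree_single, Finsupp.degree_single] at this
  exact absurd (hlt i hi) (not_lt.2 this)

lemma isNilpotent_mk_X (hlt : ∀ i, i ≠ i₀ → n i₀ < n i) {i : Fin d} (hi : i ≠ i₀) :
    IsNilpotent (Ideal.Quotient.mk (leastFormIdeal (toricIdeal K n)) (X i)) := by
  refine ⟨n i₀, ?_⟩
  rw [← map_pow, Ideal.Quotient.eq_zero_iff_mem, X_pow_eq_monomial]
  exact monomial_mem_leastFormIdeal (not_isMaxFactorization_single hlt hi)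

/-- The homomorphism from `K[X]` to the tangent cone ring sending `X` to the class of `X i₀`. -/
def axisMap (K : Type*) [Field K] {d : ℕ} (n : Fin d → ℕ) (i₀ : Fin d) :
    Polynomial K →+* TangentConeRing K n :=
  (Ideal.Quotient.mk _).comp
    (Polynomial.aeval (X i₀ : MvPolynomial (Fin d) K) : Polynomial K →ₐ[K] _).toRingHom

lemma axisMap_apply (p : Polynomial K) :
    axisMap K n i₀ p = Ideal.Quotient.mk _ (Polynomial.aeval (X i₀) p) := rfl

lemma exists_isNilpotent_sub_axisMap (hlt : ∀ i, i ≠ i₀ → n i₀ < n i) (r : TangentConeRing K n) :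
    ∃ p, IsNilpotent (r - axisMap K n i₀ p) := by
  obtain ⟨f, rfl⟩ := Ideal.Quotient.mk_surjective r
  induction f using MvPolynomial.induction_on with
  | C a =>
    refine ⟨Polynomial.C a, ?_⟩
    rw [axisMap_apply, Polynomial.aeval_C, algebraMap_eq, sub_self]
    exact IsNilpotent.zero
  | add f g hf hg =>
    obtain ⟨p, hp⟩ := hf
    obtain ⟨q, hq⟩ := hg
    refine ⟨p + q, ?_⟩
    rw [map_add, map_add, add_sub_add_comm]
    exact (Commute.all _ _).isNilpotent_add hp hq
  | mul_X f i hf =>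
    obtain ⟨p, hp⟩ := hf
    rcases eq_or_ne i i₀ with rfl | hi
    · refine ⟨p * Polynomial.X, ?_⟩
      rw [map_mul, map_mul, axisMap_apply Polynomial.X, Polynomial.aeval_X, ← sub_mul]
      exact (Commute.all _ _).isNilpotent_mul_right hp
    · refine ⟨0, ?_⟩
      rw [map_zero, sub_zero, map_mul]
      exact (Commute.all _ _).isNilpotent_mul_left (isNilpotent_mk_X hlt hi)

/-- Nilpotents lie in every prime, so a prime is determined by its contraction to `K[X]`. -/
lemma ringKrullDim_tangentConeRing_le (hlt : ∀ i, i ≠ i₀ → n i₀ < n i) :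
    ringKrullDim (TangentConeRing K n) ≤ 1 := by
  have hdim : ringKrullDim (Polynomial K) = 1 := by
    rw [Polynomial.ringKrullDim_of_isNoetherianRing, ringKrullDim_eq_zero_of_field, zero_add]
  rw [← hdim]
  have hmono : ∀ P Q : PrimeSpectrum (TangentConeRing K n),
      PrimeSpectrum.comap (axisMap K n i₀) P ≤ PrimeSpectrum.comap (axisMap K n i₀) Q →
        P ≤ Q := by
    intro P Q h r hr
    obtain ⟨p, hp⟩ := exists_isNilpotent_sub_axisMap hlt r
    have hN : ∀ P : PrimeSpectrum (TangentConeRing K n), r - axisMap K n i₀ p ∈ P.asIdeal :=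
      fun P => nilradical_le_prime P.asIdeal hp
    have h1 : axisMap K n i₀ p ∈ P.asIdeal := by
      have := P.asIdeal.sub_mem hr (hN P)
      rwa [sub_sub_cancel] at this
    have h2 : axisMap K n i₀ p ∈ Q.asIdeal := h h1
    have := Q.asIdeal.add_mem (hN Q) h2
    rwa [sub_add_cancel] at this
  refine Order.krullDim_le_of_strictMono (PrimeSpectrum.comap (axisMap K n i₀)) ?_
  intro P Q hPQ
  refine lt_of_le_not_ge (Ideal.comap_mono hPQ.le) fun h => ?_
  exact absurd (hmono _ _ h) (not_le_of_gt hPQ)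

lemma initialMap_X_mul (hmax : ∀ u, IsMaxFactorization n u →
    IsMaxFactorization n (u + Finsupp.single i₀ 1)) (f : MvPolynomial (Fin d) K) :
    initialMap K n (X i₀ * f) = Polynomial.X ^ n i₀ * initialMap K n f := by
  induction f using MvPolynomial.induction_on' with
  | add p q hp hq => rw [mul_add, map_add, hp, hq, map_add, mul_add]
  | monomial u a =>
    rw [X, monomial_mul, one_mul, add_comm _ u]
    by_cases h : IsMaxFactorization n u
    · rw [initialMap_monomial_of_isMax h, initialMap_monomial_of_isMax (hmax u h), map_add,
        Finsupp.weight_single, one_smul, Polynomial.X_pow_mul_monomial]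
    · rw [initialMap_monomial_of_not_isMax h,
        initialMap_monomial_of_not_isMax fun h' => h h'.of_add, mul_zero]

lemma initialMap_aeval_mul (hmax : ∀ u, IsMaxFactorization n u →
    IsMaxFactorization n (u + Finsupp.single i₀ 1)) (p : Polynomial K)
    (f : MvPolynomial (Fin d) K) :
    initialMap K n (Polynomial.aeval (X i₀) p * f) =
      Polynomial.expand K (n i₀) p * initialMap K n f := by
  induction p using Polynomial.induction_on generalizing f with
  | C a =>
    rw [Polynomial.aeval_C, Polynomial.expand_C, algebraMap_eq, C_mul', map_smul,
      Polynomial.smul_eq_C_mul]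
  | add p q hp hq => rw [map_add, add_mul, map_add, hp, hq, map_add, add_mul]
  | monomial k a ih =>
    rw [pow_succ, ← mul_assoc, map_mul (Polynomial.aeval _), Polynomial.aeval_X, mul_assoc, ih,
      initialMap_X_mul hmax, map_mul (Polynomial.expand K (n i₀)) _ Polynomial.X,
      Polynomial.expand_X, mul_assoc]

/-- Through `initialMap`, multiplication by `p(x_{i₀})` becomes multiplication by `p(T ^ n i₀)` in
the domain `K[T]`. -/
lemma isSMulRegular_axisMap (h₀ : 0 < n i₀) (hmax : ∀ u, IsMaxFactorization n u →
    IsMaxFactorization n (u + Finsupp.single i₀ 1)) {p : Polynomial K} (hp : p ≠ 0) :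
    IsSMulRegular (TangentConeRing K n) (axisMap K n i₀ p) := by
  rw [isSMulRegular_iff_right_eq_zero_of_smul]
  intro z hz
  obtain ⟨f, rfl⟩ := Ideal.Quotient.mk_surjective z
  rw [axisMap_apply, smul_eq_mul, ← map_mul, Ideal.Quotient.eq_zero_iff_mem,
    mem_leastFormIdeal_toricIdeal_iff, initialMap_aeval_mul hmax] at hz
  rw [Ideal.Quotient.eq_zero_iff_mem, mem_leastFormIdeal_toricIdeal_iff]
  exact (mul_eq_zero.1 hz).resolve_left ((Polynomial.expand_ne_zero h₀).2 hp)

/-- Otherwise `K[X]` would embed in the residue field, and also surject onto it because all else is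
nilpotent, making `K[X]` a field. -/
lemma exists_axisMap_mem (hlt : ∀ i, i ≠ i₀ → n i₀ < n i) (m : Ideal (TangentConeRing K n))
    [hm : m.IsMaximal] : ∃ p ≠ 0, axisMap K n i₀ p ∈ m := by
  by_contra! h
  let φ : Polynomial K →+* TangentConeRing K n ⧸ m :=
    (Ideal.Quotient.mk m).comp (axisMap K n i₀)
  have hinj : Function.Injective φ := by
    rw [injective_iff_map_eq_zero]
    intro p hp
    by_contra hp0
    exact h p hp0 (Ideal.Quotient.eq_zero_iff_mem.1 hp)
  have hsurj : Function.Surjective φ := by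
    intro z
    obtain ⟨r, rfl⟩ := Ideal.Quotient.mk_surjective z
    obtain ⟨p, hp⟩ := exists_isNilpotent_sub_axisMap hlt r
    refine ⟨p, ?_⟩
    rw [eq_comm]
    exact Ideal.Quotient.eq.2 (nilradical_le_prime m hp)
  have : IsField (TangentConeRing K n ⧸ m) := 
    (Ideal.Quotient.maximal_ideal_iff_isField_quotient m).1 hm
  exact Polynomial.not_isField K
    ((RingEquiv.ofBijective φ ⟨hinj, hsurj⟩).toMulEquiv.isField this)

lemma isCohenMacaulayLocalRing_localization_of_isSMulRegular {R : Type*} [CommRing R]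
    [IsNoetherianRing R] (hdim : ringKrullDim R ≤ 1) (m : Ideal R) [m.IsPrime] {x : R}
    (hx : IsSMulRegular R x) (hxm : x ∈ m) :
    IsCohenMacaulayLocalRing (Localization.AtPrime m) := by
  set r := algebraMap R (Localization.AtPrime m) x
  have hrm : r ∈ IsLocalRing.maximalIdeal (Localization.AtPrime m) :=
    (IsLocalization.AtPrime.to_map_mem_maximal_iff _ m _).2 hxm
  have hreg : IsSMulRegular (Localization.AtPrime m) r :=
    hx.of_isLocalization (Localization.AtPrime m) m.primeCompl
  have hN : IsNoetherianRing (Localization.AtPrime m) :=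
    IsLocalization.isNoetherianRing m.primeCompl _ inferInstance
  refine ⟨hN, [r], by simpa using hrm, ?_, le_antisymm ?_ ?_⟩
  · rw [IsLocalRing.isRegular_iff_isWeaklyRegular_of_subset_maximalIdeal (by simpa using hrm)]
    exact (RingTheory.Sequence.isWeaklyRegular_singleton_iff _ _).2 hreg
  · have hnz : r ∈ nonZeroDivisors (Localization.AtPrime m) := by
      rw [mem_nonZeroDivisors_iff_right]
      intro y hy
      refine hreg ?_
      simpa [mul_comm] using hy
    refine le_trans ?_ (ringKrullDim_quotient_succ_le_of_nonZeroDivisor hnz)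
    have hnt : Nontrivial (Localization.AtPrime m ⧸ Ideal.span {r}) := by
      rw [Ideal.Quotient.nontrivial_iff, Ne, Ideal.span_singleton_eq_top]
      exact hrm
    have := ringKrullDim_nonneg_of_nontrivial (R := Localization.AtPrime m ⧸ Ideal.span {r})
    simpa using add_le_add_left this 1
  · rw [IsLocalization.AtPrime.ringKrullDim_eq_height m]
    exact (Ideal.height_le_ringKrullDim_of_ne_top Ideal.IsPrime.ne_top').trans hdim

lemma hasCohenMacaulayTangentCone_of_isMax (h₀ : 0 < n i₀) (hlt : ∀ i, i ≠ i₀ → n i₀ < n i)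
    (hmax : ∀ u, IsMaxFactorization n u → IsMaxFactorization n (u + Finsupp.single i₀ 1)) :
    HasCohenMacaulayTangentCone K n := by
  refine ⟨inferInstance, fun m hm => ?_⟩
  obtain ⟨p, hp, hpm⟩ := exists_axisMap_mem hlt m
  exact isCohenMacaulayLocalRing_localization_of_isSMulRegular
    (ringKrullDim_tangentConeRing_le hlt) m (isSMulRegular_axisMap h₀ hmax hp) hpm

/-- Produces a socle monomial. An addition `c` keeping `u` maximal cannot involve `i₀`, and its
other coordinates stay below `n i₀`; a `c` of largest degree is therefore available. -/
lemma exists_isMax_forall_not_isMax_add (h₀ : 0 < n i₀) (hlt : ∀ i, i ≠ i₀ → n i₀ < n i)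
    {u : Fin d →₀ ℕ} (hu : IsMaxFactorization n u)
    (hu' : ¬ IsMaxFactorization n (u + Finsupp.single i₀ 1)) :
    ∃ w, IsMaxFactorization n w ∧ ∀ c, c ≠ 0 → ¬ IsMaxFactorization n (w + c) := by
  have hbound : ∀ c, IsMaxFactorization n (u + c) → c.degree ≤ ∑ _i : Fin d, n i₀ := by
    intro c hc
    rw [Finsupp.degree_eq_sum]
    refine Finset.sum_le_sum fun i _ => ?_
    by_contra! hi
    rcases eq_or_ne i i₀ with rfl | hne
    · have hle : Finsupp.single i 1 ≤ c := Finsupp.single_le_iff.2 (by omega)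
      obtain ⟨e, rfl⟩ := exists_add_of_le hle
      rw [← add_assoc] at hc
      exact hu' hc.of_add
    · have hle : Finsupp.single i (n i₀) ≤ c := Finsupp.single_le_iff.2 hi.le
      obtain ⟨e, rfl⟩ := exists_add_of_le hle
      exact not_isMaxFactorization_single hlt hne hc.of_add_left.of_add
  have hb : BddAbove {k | ∃ c, IsMaxFactorization n (u + c) ∧ c.degree = k} := ⟨_, by
    rintro k ⟨c, hc, rfl⟩
    exact hbound c hc⟩
  have hne : {k | ∃ c, IsMaxFactorization n (u + c) ∧ c.degree = k}.Nonempty :=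
    ⟨0, 0, by simpa using hu, map_zero _⟩
  obtain ⟨c, hc, hk⟩ := Nat.sSup_mem hne hb
  refine ⟨u + c, hc, fun e he hmax => he ?_⟩
  rw [add_assoc] at hmax
  have := hk ▸ le_csSup hb ⟨c + e, hmax, rfl⟩
  rw [map_add] at this
  rw [← Finsupp.degree_eq_zero_iff]
  omega

lemma initialMap_mul_monomial {w : Fin d →₀ ℕ} (hw : IsMaxFactorization n w)
    (hw' : ∀ c, c ≠ 0 → ¬ IsMaxFactorization n (w + c)) (f : MvPolynomial (Fin d) K) :
    initialMap K n (f * monomial w 1) =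
      Polynomial.monomial (Finsupp.weight n w) (constantCoeff f) := by
  induction f using MvPolynomial.induction_on' with
  | add p q hp hq => rw [add_mul, map_add, hp, hq, map_add, map_add]
  | monomial c a =>
    rw [monomial_mul, mul_one, add_comm]
    rcases eq_or_ne c 0 with rfl | hc
    · rw [add_zero, initialMap_monomial_of_isMax hw, constantCoeff_monomial, if_pos rfl]
    · rw [initialMap_monomial_of_not_isMax (hw' c hc), constantCoeff_monomial, if_neg hc, map_zero]

lemma coeff_initialMap_mul_X_pow (h₀ : 0 < n i₀) (hlt : ∀ i, i ≠ i₀ → n i₀ < n i)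
    (f : MvPolynomial (Fin d) K) (k : ℕ) :
    (initialMap K n (f * X i₀ ^ k)).coeff (k * n i₀) = constantCoeff f := by
  induction f using MvPolynomial.induction_on' with
  | add p q hp hq => rw [add_mul, map_add, Polynomial.coeff_add, hp, hq, map_add]
  | monomial c a =>
    rw [X_pow_eq_monomial, monomial_mul, mul_one, constantCoeff_monomial]
    rcases eq_or_ne c 0 with rfl | hc
    · rw [zero_add, initialMap_monomial_of_isMax (isMaxFactorization_single h₀ hlt k),
        Finsupp.weight_single, smul_eq_mul, Polynomial.coeff_monomial, if_pos rfl, if_pos rfl]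
    · rw [if_neg hc]
      by_cases h : IsMaxFactorization n (c + Finsupp.single i₀ k)
      · rw [initialMap_monomial_of_isMax h, Polynomial.coeff_monomial, if_neg]
        rw [map_add, Finsupp.weight_single, smul_eq_mul]
        have hpos : ∀ i, 0 < n i := fun i => by
          rcases eq_or_ne i i₀ with rfl | hi
          exacts [h₀, h₀.trans (hlt i hi)]
        have := degree_le_weight hpos c
        have h1 : c.degree ≠ 0 := by rwa [Ne, Finsupp.degree_eq_zero_iff]
        omega
      · rw [initialMap_monomial_of_not_isMax h, Polynomial.coeff_zero]

/-- If maximality is lost, a nonzero monomial is annihilated exactly by the ideal `m` of the origin,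
so the local ring there has depth zero; yet its dimension is not zero, as `x_{i₀}` is not nilpotent
in it. -/
lemma isMax_of_hasCohenMacaulayTangentCone (h₀ : 0 < n i₀) (hlt : ∀ i, i ≠ i₀ → n i₀ < n i)
    (hCM : HasCohenMacaulayTangentCone K n) {u : Fin d →₀ ℕ} (hu : IsMaxFactorization n u) :
    IsMaxFactorization n (u + Finsupp.single i₀ 1) := by
  by_contra hu'
  obtain ⟨w, hw, hw'⟩ := exists_isMax_forall_not_isMax_add h₀ hlt hu hu'
  have hmul : ∀ f : MvPolynomial (Fin d) K,
      f * monomial w 1 ∈ leastFormIdeal (toricIdeal K n) ↔ constantCoeff f = 0 := fun f => by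
    rw [mem_leastFormIdeal_toricIdeal_iff, initialMap_mul_monomial hw hw',
      Polynomial.monomial_eq_zero_iff]
  let ε : TangentConeRing K n →+* K := Ideal.Quotient.lift _ constantCoeff fun f hf =>
    (hmul f).1 (Ideal.mul_mem_right _ _ hf)
  have hε : Function.Surjective ε := fun a => ⟨Ideal.Quotient.mk _ (C a), by simp [ε]⟩
  let m := RingHom.ker ε
  have hm : m.IsMaximal := RingHom.ker_isMaximal_of_surjective ε hε
  have hmk : ∀ f, Ideal.Quotient.mk _ f ∈ m ↔ constantCoeff f = 0 := fun f => by
    rw [RingHom.mem_ker, Ideal.Quotient.lift_mk]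
  set z : TangentConeRing K n := Ideal.Quotient.mk _ (monomial w 1)
  have hz : ∀ a, a * z = 0 ↔ a ∈ m := fun a => by
    obtain ⟨f, rfl⟩ := Ideal.Quotient.mk_surjective a
    rw [← map_mul, Ideal.Quotient.eq_zero_iff_mem, hmul, hmk]
  obtain ⟨-, rs, hrs, hreg, hlen⟩ := hCM.2 m
  cases rs with
  | cons r rs =>
    have hr : r ∈ IsLocalRing.maximalIdeal (Localization.AtPrime m) := hrs r (by simp)
    have hr' := ((RingTheory.Sequence.isRegular_cons_iff _ _ _).1 hreg).1
    rw [isSMulRegular_iff_right_eq_zero_of_smul] at hr'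
    obtain ⟨a, s, rfl⟩ := IsLocalization.exists_mk'_eq m.primeCompl r
    rw [IsLocalization.AtPrime.mk'_mem_maximal_iff _ m] at hr
    -- A regular element of the maximal ideal kills `z`, so `z` would vanish in the localization.
    have hz0 := hr' (algebraMap _ _ z) (by
      rw [smul_eq_mul, mul_comm, IsLocalization.mul_mk'_eq_mk'_of_mul, mul_comm,
        (hz a).2 hr, IsLocalization.mk'_zero])
    obtain ⟨t, ht⟩ := (IsLocalization.map_eq_zero_iff m.primeCompl _ z).1 hz0
    exact t.2 ((hz _).1 ht)
  | nil =>
    have : Ring.KrullDimLE 0 (Localization.AtPrime m) :=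
      ringKrullDimZero_iff_ringKrullDim_eq_zero.2 (by rw [← hlen]; rfl)
    have hx : algebraMap _ (Localization.AtPrime m)
        (Ideal.Quotient.mk (leastFormIdeal (toricIdeal K n)) (X i₀)) ∈
        IsLocalRing.maximalIdeal (Localization.AtPrime m) :=
      (IsLocalization.AtPrime.to_map_mem_maximal_iff _ m _).2 ((hmk _).2 (by simp))
    obtain ⟨k, hk⟩ := Ring.KrullDimLE.isNilpotent_iff_mem_maximalIdeal.2 hx
    rw [← map_pow] at hk
    obtain ⟨⟨t, ht⟩, htk⟩ := (IsLocalization.map_eq_zero_iff m.primeCompl _ _).1 hk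
    obtain ⟨f, rfl⟩ := Ideal.Quotient.mk_surjective t
    rw [← map_pow, ← map_mul, Ideal.Quotient.eq_zero_iff_mem,
      mem_leastFormIdeal_toricIdeal_iff] at htk
    refine ht ((hmk f).2 ?_)
    rw [← coeff_initialMap_mul_X_pow h₀ hlt f k, htk, Polynomial.coeff_zero]

theorem hasCohenMacaulayTangentCone_iff (h₀ : 0 < n i₀) (hlt : ∀ i, i ≠ i₀ → n i₀ < n i) :
    HasCohenMacaulayTangentCone K n ↔ ∀ u, IsMaxFactorization n u →
      IsMaxFactorization n (u + Finsupp.single i₀ 1) :=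
  ⟨fun h _ hu => isMax_of_hasCohenMacaulayTangentCone h₀ hlt h hu,
    hasCohenMacaulayTangentCone_of_isMax h₀ hlt⟩

end CohenMacaulay

/-! ### Exchange moves and weight classes -/

section Gorenstein

/-- A predicate on exponent vectors `(x, y, z, t)` that takes the same value on both monomials of
any monomial multiple of one of the binomials in `gorensteinBinomials`. -/
structure MoveClosed (a₁ a₂ a₃ a₄ a₁₂ a₁₃ a₂₁ a₂₄ a₃₂ a₃₄ a₄₁ a₄₃ : ℕ)
    (G : ℕ → ℕ → ℕ → ℕ → Prop) : Prop where
  first : ∀ x y z t, G (x + a₁) y z t ↔ G x (y + a₁₂) (z + a₁₃) t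
  second : ∀ x y z t, G x (y + a₂) z t ↔ G (x + a₂₁) y z (t + a₂₄)
  third : ∀ x y z t, G x y (z + a₃) t ↔ G x (y + a₃₂) z (t + a₃₄)
  fourth : ∀ x y z t, G x y z (t + a₄) ↔ G (x + a₄₁) y (z + a₄₃) t
  fifth : ∀ x y z t, G (x + a₄₁) (y + a₃₂) z t ↔ G x y (z + a₁₃) (t + a₂₄)

/-- The linear functional summing the coefficients of the monomials that satisfy `F`. -/
def coeffSum (K : Type*) [Field K] {σ : Type*} (F : (σ →₀ ℕ) → Prop) [DecidablePred F] :
    MvPolynomial σ K →ₗ[K] K :=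
  (basisMonomials σ K).constr K fun u => if F u then 1 else 0

lemma coeffSum_monomial {K : Type*} [Field K] {σ : Type*} (F : (σ →₀ ℕ) → Prop) [DecidablePred F]
    (u : σ →₀ ℕ) : coeffSum K F (monomial u 1) = if F u then 1 else 0 := by
  have : monomial u (1 : K) = basisMonomials σ K u := by simp
  rw [this, coeffSum, Module.Basis.constr_basis]

lemma coeffSum_mul_eq_zero {K : Type*} [Field K] {σ : Type*} {F : (σ →₀ ℕ) → Prop}
    [DecidablePred F] {p q : σ →₀ ℕ} (h : ∀ c, F (c + p) ↔ F (c + q)) (f : MvPolynomial σ K) :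
    coeffSum K F (f * (monomial p 1 - monomial q 1)) = 0 := by
  induction f using MvPolynomial.induction_on' with
  | add f g hf hg => rw [add_mul, map_add, hf, hg, add_zero]
  | monomial c a =>
    have : monomial c a = a • monomial c (1 : K) := by simp [smul_monomial]
    rw [this, smul_mul_assoc, map_smul, mul_sub, monomial_mul, monomial_mul, map_sub, one_mul,
      coeffSum_monomial, coeffSum_monomial]
    simp only [h, sub_self, smul_zero]

/-- The sum of the coefficients on `F` vanishes on the whole ideal; applied to `u - v` it compares
`F u` with `F v`. -/
lemma iff_of_monomial_sub_monomial_mem_span {K : Type*} [Field K] {σ : Type*}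
    {F : (σ →₀ ℕ) → Prop} {S : Set (MvPolynomial σ K)}
    (hS : ∀ s ∈ S, ∃ p q, s = monomial p 1 - monomial q 1 ∧ ∀ c, F (c + p) ↔ F (c + q))
    {u v : σ →₀ ℕ} (h : monomial u (1 : K) - monomial v 1 ∈ Ideal.span S) : F u ↔ F v := by
  classical
  have key : ∀ g ∈ Ideal.span S, ∀ f, coeffSum K F (f * g) = 0 := by
    intro g hg
    refine Submodule.span_induction ?_ ?_ ?_ ?_ hg
    · intro s hs f
      obtain ⟨p, q, rfl, hpq⟩ := hS s hs
      exact coeffSum_mul_eq_zero hpq f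
    · intro f
      rw [mul_zero, map_zero]
    · intro x y _ _ hx hy f
      rw [mul_add, map_add, hx, hy, add_zero]
    · intro a x _ hx f
      rw [smul_eq_mul, ← mul_assoc, hx]
  have := key _ h 1
  rw [one_mul, map_sub, coeffSum_monomial, coeffSum_monomial, sub_eq_zero] at this
  by_cases hu : F u <;> by_cases hv : F v <;> simp_all

/-- The exponent vector of `x_1 ^ x * x_2 ^ y * x_3 ^ z * x_4 ^ t`. -/
def expVec (x y z t : ℕ) : Fin 4 →₀ ℕ := Finsupp.equivFunOnFinite.symm ![x, y, z, t]

/-- The weight of `x_1 ^ x * x_2 ^ y * x_3 ^ z * x_4 ^ t`. -/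
def expWeight (n : Fin 4 → ℕ) (x y z t : ℕ) : ℕ := x * n 0 + y * n 1 + z * n 2 + t * n 3

lemma eq_expVec (u : Fin 4 →₀ ℕ) : u = expVec (u 0) (u 1) (u 2) (u 3) := by
  ext i
  fin_cases i <;> rfl

lemma degree_expVec (x y z t : ℕ) : (expVec x y z t).degree = x + y + z + t := by
  rw [Finsupp.degree_eq_sum, Fin.sum_univ_four]
  rfl

lemma weight_expVec (n : Fin 4 → ℕ) (x y z t : ℕ) :
    Finsupp.weight n (expVec x y z t) = expWeight n x y z t := by
  rw [Finsupp.weight_eq_sum, Fin.sum_univ_four]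
  rfl

lemma expVec_add (x y z t x' y' z' t' : ℕ) :
    expVec x y z t + expVec x' y' z' t' = expVec (x + x') (y + y') (z + z') (t + t') := by
  ext i
  fin_cases i <;> rfl

lemma monomial_expVec (K : Type*) [Field K] (x y z t : ℕ) :
    monomial (expVec x y z t) (1 : K) = X 0 ^ x * X 1 ^ y * X 2 ^ z * X 3 ^ t := by
  rw [monomial_eq, C_1, one_mul, Finsupp.prod_fintype _ _ (by simp), Fin.prod_univ_four]
  rfl

variable {K : Type*} [Field K] {n : Fin 4 → ℕ}
  {a₁ a₂ a₃ a₄ a₁₂ a₁₃ a₂₁ a₂₄ a₃₂ a₃₄ a₄₁ a₄₃ : ℕ}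

lemma gorensteinBinomials_eq : gorensteinBinomials K a₁ a₂ a₃ a₄ a₁₂ a₁₃ a₂₁ a₂₄ a₃₂ a₃₄ a₄₁ a₄₃ =
    {monomial (expVec a₁ 0 0 0) 1 - monomial (expVec 0 a₁₂ a₁₃ 0) 1,
      monomial (expVec 0 a₂ 0 0) 1 - monomial (expVec a₂₁ 0 0 a₂₄) 1,
      monomial (expVec 0 0 a₃ 0) 1 - monomial (expVec 0 a₃₂ 0 a₃₄) 1,
      monomial (expVec 0 0 0 a₄) 1 - monomial (expVec a₄₁ 0 a₄₃ 0) 1,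
      monomial (expVec a₄₁ a₃₂ 0 0) 1 - monomial (expVec 0 0 a₁₃ a₂₄) 1} := by
  simp only [monomial_expVec, pow_zero, mul_one, one_mul]
  rfl

lemma MoveClosed.iff_of_weight_eq
    (hgen : toricIdeal K n = Ideal.span (gorensteinBinomials K
      a₁ a₂ a₃ a₄ a₁₂ a₁₃ a₂₁ a₂₄ a₃₂ a₃₄ a₄₁ a₄₃))
    {G : ℕ → ℕ → ℕ → ℕ → Prop} (hG : MoveClosed a₁ a₂ a₃ a₄ a₁₂ a₁₃ a₂₁ a₂₄ a₃₂ a₃₄ a₄₁ a₄₃ G)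
    {x y z t x' y' z' t' : ℕ} (h : expWeight n x y z t = expWeight n x' y' z' t') :
    G x y z t ↔ G x' y' z' t' := by
  rw [← weight_expVec, ← weight_expVec] at h
  have hmem := monomial_sub_monomial_mem_toricIdeal (K := K) h
  rw [hgen, gorensteinBinomials_eq] at hmem
  have hF : ∀ {p q : Fin 4 →₀ ℕ}, (∀ x y z t,
      G (x + p 0) (y + p 1) (z + p 2) (t + p 3) ↔ G (x + q 0) (y + q 1) (z + q 2) (t + q 3)) →
      ∃ p' q', monomial p (1 : K) - monomial q 1 = monomial p' 1 - monomial q' 1 ∧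
        ∀ c : Fin 4 →₀ ℕ, (fun u : Fin 4 →₀ ℕ => G (u 0) (u 1) (u 2) (u 3)) (c + p') ↔
          (fun u : Fin 4 →₀ ℕ => G (u 0) (u 1) (u 2) (u 3)) (c + q') :=
    fun {p q} h => ⟨p, q, rfl, fun c => h (c 0) (c 1) (c 2) (c 3)⟩
  refine iff_of_monomial_sub_monomial_mem_span
    (F := fun u : Fin 4 →₀ ℕ => G (u 0) (u 1) (u 2) (u 3)) ?_ hmem
  rintro s (rfl | rfl | rfl | rfl | rfl)
  exacts [hF hG.first, hF hG.second, hF hG.third, hF hG.fourth, hF hG.fifth]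

lemma expWeight_eq_of_generators
    (hgen : toricIdeal K n = Ideal.span (gorensteinBinomials K
      a₁ a₂ a₃ a₄ a₁₂ a₁₃ a₂₁ a₂₄ a₃₂ a₃₄ a₄₁ a₄₃)) :
    expWeight n a₁ 0 0 0 = expWeight n 0 a₁₂ a₁₃ 0 ∧
    expWeight n 0 a₂ 0 0 = expWeight n a₂₁ 0 0 a₂₄ ∧
    expWeight n 0 0 a₃ 0 = expWeight n 0 a₃₂ 0 a₃₄ ∧
    expWeight n 0 0 0 a₄ = expWeight n a₄₁ 0 a₄₃ 0 ∧
    expWeight n a₄₁ a₃₂ 0 0 = expWeight n 0 0 a₁₃ a₂₄ := by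
  have h : ∀ s ∈ gorensteinBinomials K a₁ a₂ a₃ a₄ a₁₂ a₁₃ a₂₁ a₂₄ a₃₂ a₃₄ a₄₁ a₄₃,
      s ∈ toricIdeal K n := fun s hs => hgen ▸ Ideal.subset_span hs
  rw [gorensteinBinomials_eq] at h
  simp only [← weight_expVec]
  refine ⟨?_, ?_, ?_, ?_, ?_⟩ <;>
  exact weight_eq_of_monomial_sub_monomial_mem (h _ (by simp))

/-- The tuple `(x, y, z, t)` has the weight of a tuple of at least the same degree that involves the
first variable. -/
def HasAxialReplacement (n : Fin 4 → ℕ) (x y z t : ℕ) : Prop :=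
  ∃ x' y' z' t', expWeight n (x' + 1) y' z' t' = expWeight n x y z t ∧
    x + y + z + t ≤ x' + 1 + y' + z' + t'

lemma HasAxialReplacement.mono {x y z t x' y' z' t' : ℕ} (h : HasAxialReplacement n x y z t)
    (hx : x ≤ x') (hy : y ≤ y') (hz : z ≤ z') (ht : t ≤ t') :
    HasAxialReplacement n x' y' z' t' := by
  obtain ⟨p, q, r, s, hw, hd⟩ := h
  obtain ⟨x, rfl⟩ := exists_add_of_le hx
  obtain ⟨y, rfl⟩ := exists_add_of_le hy
  obtain ⟨z, rfl⟩ := exists_add_of_le hz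
  obtain ⟨t, rfl⟩ := exists_add_of_le ht
  refine ⟨p + x, q + y, r + z, s + t, ?_, by omega⟩
  simp only [expWeight] at hw ⊢
  linarith

/-- Cancelling one `x₁` turns partners divisible by `x₁` into competitors of a maximal
factorization, and conversely. -/
lemma forall_isMax_add_single_iff (hn : ∀ i, 0 < n i) :
    (∀ u, IsMaxFactorization n u → IsMaxFactorization n (u + Finsupp.single 0 1)) ↔
      ∀ x y z t x' y' z' t', expWeight n (x' + 1) y' z' t' = expWeight n x y z t →
        HasAxialReplacement n x y z t := by
  have hsingle : Finsupp.single (0 : Fin 4) 1 = expVec 1 0 0 0 := by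
    ext i
    fin_cases i <;> simp [expVec]
  rw [hsingle]
  constructor
  · intro h x y z t x' y' z' t' hw
    obtain ⟨u, hu, hmax⟩ := exists_isMaxFactorization hn (expVec x' y' z' t')
    rw [eq_expVec u] at hu hmax
    have hmax' := h _ hmax
    rw [weight_expVec, weight_expVec] at hu
    rw [expVec_add] at hmax'
    have hw' : expWeight n (u 0 + 1) (u 1 + 0) (u 2 + 0) (u 3 + 0) = expWeight n x y z t := by
      simp only [expWeight] at hu hw ⊢
      linarith
    have := hmax' (expVec x y z t) (by rw [weight_expVec, weight_expVec, hw'])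
    rw [degree_expVec, degree_expVec] at this
    exact ⟨_, _, _, _, hw', this⟩
  · intro h u hu v hv
    rw [eq_expVec u] at hu hv ⊢
    rw [eq_expVec v] at hv ⊢
    rw [expVec_add, weight_expVec, weight_expVec] at hv
    obtain ⟨x, y, z, t, hw, hd⟩ := h _ _ _ _ _ _ _ _ hv.symm
    have := hu (expVec x y z t) (by
      rw [weight_expVec, weight_expVec]
      simp only [expWeight] at hv hw ⊢
      linarith)
    rw [degree_expVec, degree_expVec] at this
    rw [expVec_add, degree_expVec, degree_expVec]
    omega

/-! ### Relations between the exponents -/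

lemma moveClosed_pure_first (ha₁₂ : 0 < a₁₂) (ha₂ : 0 < a₂) (ha₂₄ : 0 < a₂₄) (ha₃ : 0 < a₃)
    (ha₃₂ : 0 < a₃₂) (ha₄ : 0 < a₄) (ha₄₃ : 0 < a₄₃) {k : ℕ} (hk : k < a₁) :
    MoveClosed a₁ a₂ a₃ a₄ a₁₂ a₁₃ a₂₁ a₂₄ a₃₂ a₃₄ a₄₁ a₄₃
      fun x y z t => x = k ∧ y = 0 ∧ z = 0 ∧ t = 0 := by
  constructor <;> intros <;> constructor <;> omega

lemma moveClosed_pure_third (ha₁ : 0 < a₁) (ha₁₂ : 0 < a₁₂) (ha₂ : 0 < a₂)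
    (ha₃₂ : 0 < a₃₂) (ha₄ : 0 < a₄) (ha₄₁ : 0 < a₄₁) (ha₂₄ : 0 < a₂₄) {k : ℕ} (hk : k < a₃) :
    MoveClosed a₁ a₂ a₃ a₄ a₁₂ a₁₃ a₂₁ a₂₄ a₃₂ a₃₄ a₄₁ a₄₃
      fun x y z t => x = 0 ∧ y = 0 ∧ z = k ∧ t = 0 := by
  constructor <;> intros <;> constructor <;> omega

lemma eq_and_eq_of_mul_add_mul_eq {a b c e p q : ℕ} (hq : 0 < q)
    (h : a * p + b * q = c * p + e * q) (hc : 0 < c) (hca : c < 2 * a)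
    (hne : ∀ k l, 0 < k → k < a → k * p ≠ l * q) : a = c ∧ b = e := by
  rcases lt_trichotomy a c with hac | rfl | hac
  · exfalso
    obtain ⟨k, rfl⟩ := exists_add_of_le hac.le
    have hk : k * p + e * q = b * q := by linarith
    obtain ⟨l, rfl⟩ := exists_add_of_le
      (Nat.le_of_mul_le_mul_right (hk ▸ Nat.le_add_left _ _) hq : e ≤ b)
    exact hne k l (by omega) (by omega) (by linarith)
  · exact ⟨rfl, Nat.eq_of_mul_eq_mul_right hq (by omega)⟩
  · exfalso
    obtain ⟨k, rfl⟩ := exists_add_of_le hac.le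
    have hk : k * p + b * q = e * q := by linarith
    obtain ⟨l, rfl⟩ := exists_add_of_le
      (Nat.le_of_mul_le_mul_right (hk ▸ Nat.le_add_left _ _) hq : b ≤ e)
    exact hne k l (by omega) (by omega) (by linarith)

/-- Adding generators one and two, or three and four, and substituting the fifth gives two weight
identities, in `n₁, n₂` and in `n₃, n₄`. Small pure powers of `x₁` and `x₃` are alone in their
weight classes, so the coefficients must agree. -/
lemma exponent_relations
    (h₁₂ : 0 < a₁₂ ∧ a₁₂ < a₂) (h₁₃ : 0 < a₁₃ ∧ a₁₃ < a₃)
    (h₂₁ : 0 < a₂₁ ∧ a₂₁ < a₁) (h₂₄ : 0 < a₂₄ ∧ a₂₄ < a₄)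
    (h₃₂ : 0 < a₃₂ ∧ a₃₂ < a₂) (h₃₄ : 0 < a₃₄ ∧ a₃₄ < a₄)
    (h₄₁ : 0 < a₄₁ ∧ a₄₁ < a₁) (h₄₃ : 0 < a₄₃ ∧ a₄₃ < a₃) (hn : ∀ i, 0 < n i)
    (hgen : toricIdeal K n = Ideal.span (gorensteinBinomials K
      a₁ a₂ a₃ a₄ a₁₂ a₁₃ a₂₁ a₂₄ a₃₂ a₃₄ a₄₁ a₄₃)) :
    a₁ = a₂₁ + a₄₁ ∧ a₂ = a₁₂ + a₃₂ ∧ a₃ = a₁₃ + a₄₃ ∧ a₄ = a₂₄ + a₃₄ := by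
  obtain ⟨e₁, e₂, e₃, e₄, e₅⟩ := expWeight_eq_of_generators hgen
  simp only [expWeight, zero_mul, zero_add, add_zero] at e₁ e₂ e₃ e₄ e₅
  have pure_first : ∀ k l, 0 < k → k < a₁ → k * n 0 ≠ l * n 1 := fun k l hk hk' h => by
    have := (moveClosed_pure_first (a₂₁ := a₂₁) (a₁₃ := a₁₃) (a₃₄ := a₃₄) (a₄₁ := a₄₁) h₁₂.1
      (by omega) h₂₄.1 (by omega) h₃₂.1 (by omega) h₄₃.1 hk').iff_of_weight_eq hgen
      (x := k) (y := 0) (z := 0) (t := 0) (x' := 0) (y' := l) (z' := 0) (t' := 0)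
      (by simpa [expWeight] using h)
    omega
  have pure_third : ∀ k l, 0 < k → k < a₃ → k * n 2 ≠ l * n 3 := fun k l hk hk' h => by
    have := (moveClosed_pure_third (a₁₃ := a₁₃) (a₃₄ := a₃₄) (a₄₃ := a₄₃) (by omega) h₁₂.1
      (by omega) h₃₂.1 (by omega) h₄₁.1 h₂₄.1 hk').iff_of_weight_eq hgen
      (x := 0) (y := 0) (z := k) (t := 0) (x' := 0) (y' := 0) (z' := 0) (t' := l)
      (by simpa [expWeight] using h)
    omega
  have hn1 := hn 1
  have hn3 := hn 3
  have s₁ : a₁ * n 0 + a₂ * n 1 = (a₂₁ + a₄₁) * n 0 + (a₁₂ + a₃₂) * n 1 := by linarith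
  have s₂ : a₃ * n 2 + a₄ * n 3 = (a₁₃ + a₄₃) * n 2 + (a₂₄ + a₃₄) * n 3 := by linarith
  have r₁ := eq_and_eq_of_mul_add_mul_eq hn1 s₁ (by omega) (by omega) pure_first
  have r₂ := eq_and_eq_of_mul_add_mul_eq hn3 s₂ (by omega) (by omega) pure_third
  exact ⟨r₁.1, r₁.2, r₂.1, r₂.2⟩

/-! ### Reduction to two monomials and their weight classes -/

/-- These are the monomials free of `x₁` and divisible by none of the five critical monomials. The
bound `a₂₄ ≤ a₃₄` matters for the third exchange: a multiple of `x₄^a₃₄` satisfies the last clause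
only if `z < a₁₃`. -/
lemma moveClosed_initial_complement (h₁₂ : 0 < a₁₂) (h₁₃ : 0 < a₁₃) (h₂₁ : 0 < a₂₁)
    (h₂₄ : 0 < a₂₄) (h₃₂ : 0 < a₃₂) (h₃₄ : 0 < a₃₄) (h₄₁ : 0 < a₄₁) (h₄₃ : 0 < a₄₃)
    (hle : a₂₄ ≤ a₃₄) :
    MoveClosed (a₂₁ + a₄₁) (a₁₂ + a₃₂) (a₁₃ + a₄₃) (a₂₄ + a₃₄) a₁₂ a₁₃ a₂₁ a₂₄ a₃₂ a₃₄ a₄₁ a₄₃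
      fun x y z t => x = 0 ∧ y < a₁₂ + a₃₂ ∧ t < a₂₄ + a₃₄ ∧ z < a₁₃ + a₄₃ + a₁₃ ∧
        (y < a₁₂ ∨ z < a₁₃) ∧ (z < a₁₃ ∨ t < a₂₄) := by
  constructor <;> intros <;> constructor <;> omega

lemma moveClosed_fiber_second (h₁₂ : 0 < a₁₂) (h₁₃ : 0 < a₁₃) (h₂₁ : 0 < a₂₁)
    (h₂₄ : 0 < a₂₄) (h₃₂ : 0 < a₃₂) (h₃₄ : 0 < a₃₄) (h₄₁ : 0 < a₄₁) (h₄₃ : 0 < a₄₃) :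
    MoveClosed (a₂₁ + a₄₁) (a₁₂ + a₃₂) (a₁₃ + a₄₃) (a₂₄ + a₃₄) a₁₂ a₁₃ a₂₁ a₂₄ a₃₂ a₃₄ a₄₁ a₄₃
      fun x y z t => (x = 0 ∧ y = a₁₂ + a₃₂ ∧ z = 0 ∧ t = 0) ∨
        (x = a₂₁ ∧ y = 0 ∧ z = 0 ∧ t = a₂₄) := by
  constructor <;> intros <;> constructor <;> omega

/-- The complete weight class of `x₃^(a₃+a₁₃)`. The `j`-th member arises from `x₁^a₁ x₂^(a₃₂-a₁₂)
x₄^a₃₄` by `j` exchanges of `x₁^a₂₁ x₄^a₂₄` for `x₂^a₂`; it exists only when no exponent is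
negative. -/
lemma moveClosed_fiber_third (h₁₂ : 0 < a₁₂) (h₁₃ : 0 < a₁₃) (h₂₁ : 0 < a₂₁)
    (h₂₄ : 0 < a₂₄) (h₃₂ : 0 < a₃₂) (h₃₄ : 0 < a₃₄) (h₄₁ : 0 < a₄₁) (h₄₃ : 0 < a₄₃) :
    MoveClosed (a₂₁ + a₄₁) (a₁₂ + a₃₂) (a₁₃ + a₄₃) (a₂₄ + a₃₄) a₁₂ a₁₃ a₂₁ a₂₄ a₃₂ a₃₄ a₄₁ a₄₃
      fun x y z t => (x = 0 ∧ y = 0 ∧ z = a₁₃ + a₄₃ + a₁₃ ∧ t = 0) ∨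
        (x = 0 ∧ y = a₃₂ ∧ z = a₁₃ ∧ t = a₃₄) ∨
        ∃ j, x + j * a₂₁ = a₂₁ + a₄₁ ∧ y + a₁₂ = a₃₂ + j * (a₁₂ + a₃₂) ∧ z = 0 ∧
          t + j * a₂₄ = a₃₄ := by
  constructor
  · intro x y z t
    constructor
    · rintro (h | h | ⟨_ | j, h⟩)
      · omega
      · omega
      · simp only [zero_mul] at h
        omega
      · simp only [add_mul] at h
        omega
    · rintro (h | h | ⟨j, h⟩)
      · omega
      · exact Or.inr (Or.inr ⟨0, by simp only [zero_mul]; omega⟩)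
      · omega
  · intro x y z t
    constructor
    · rintro (h | h | ⟨_ | j, h⟩)
      · omega
      · omega
      · simp only [zero_mul] at h
        omega
      · simp only [add_mul j 1, one_mul] at h
        exact Or.inr (Or.inr ⟨j, by omega⟩)
    · rintro (h | h | ⟨j, h⟩)
      · omega
      · omega
      · refine Or.inr (Or.inr ⟨j + 1, ?_⟩)
        simp only [add_mul j 1, one_mul]
        omega
  · intro x y z t
    constructor
    · rintro (h | h | ⟨j, h⟩) <;> omega
    · rintro (h | h | ⟨_ | j, h⟩)
      · omega
      · omega
      · simp only [zero_mul] at h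
        omega
      · simp only [add_mul j 1, one_mul] at h
        omega
  · intro x y z t
    constructor
    · rintro (h | h | ⟨j, h⟩) <;> omega
    · rintro (h | h | ⟨j, h⟩) <;> omega
  · intro x y z t
    constructor
    · rintro (h | h | ⟨_ | _ | j, h⟩)
      · omega
      · omega
      · simp only [zero_mul] at h
        omega
      · simp only [zero_add, one_mul] at h
        omega
      · rw [Nat.succ_mul _ a₂₁, Nat.succ_mul _ a₂₁] at h
        omega
    · rintro (h | h | ⟨j, h⟩)
      · omega
      · refine Or.inr (Or.inr ⟨1, ?_⟩)
        simp only [one_mul]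
        omega
      · omega

lemma forall_hasAxialReplacement_iff (hn_pos : ∀ i, 0 < n i) (hn_lt : StrictMono n)
    (h₁₂ : 0 < a₁₂) (h₁₃ : 0 < a₁₃) (h₂₁ : 0 < a₂₁) (h₂₄ : 0 < a₂₄) (h₃₂ : 0 < a₃₂)
    (h₃₄ : 0 < a₃₄) (h₄₁ : 0 < a₄₁) (h₄₃ : 0 < a₄₃)
    (hgen : toricIdeal K n = Ideal.span (gorensteinBinomials K
      (a₂₁ + a₄₁) (a₁₂ + a₃₂) (a₁₃ + a₄₃) (a₂₄ + a₃₄) a₁₂ a₁₃ a₂₁ a₂₄ a₃₂ a₃₄ a₄₁ a₄₃))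
    (hle : a₂₄ ≤ a₃₄) :
    (∀ x y z t x' y' z' t', expWeight n (x' + 1) y' z' t' = expWeight n x y z t →
        HasAxialReplacement n x y z t) ↔
      HasAxialReplacement n 0 (a₁₂ + a₃₂) 0 0 ∧
        HasAxialReplacement n 0 0 (a₁₃ + a₄₃ + a₁₃) 0 := by
  obtain ⟨e₁, e₂, e₃, e₄, e₅⟩ := expWeight_eq_of_generators hgen
  have lt₀₁ : n 0 < n 1 := hn_lt (by decide)
  have lt₁₂ : n 1 < n 2 := hn_lt (by decide)
  have lt₂₃ : n 2 < n 3 := hn_lt (by decide)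
  have hn0 := hn_pos 0
  constructor
  · intro h
    constructor
    · refine h _ _ _ _ (a₂₁ - 1) 0 0 a₂₄ ?_
      rw [Nat.sub_add_cancel h₂₁]
      exact e₂.symm
    · refine h _ _ _ _ (a₄₁ - 1) (a₃₂ + a₃₂) 0 (a₃₄ - a₂₄) ?_
      rw [Nat.sub_add_cancel h₄₁]
      obtain ⟨c, rfl⟩ := exists_add_of_le hle
      rw [Nat.add_sub_cancel_left]
      simp only [expWeight] at e₃ e₅ ⊢
      linarith
  · rintro ⟨hg₂, hg₃⟩ x y z t x' y' z' t' hw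
    rcases Nat.eq_zero_or_pos x with rfl | hx
    swap
    · exact ⟨x - 1, y, z, t, by rw [Nat.sub_add_cancel hx], by omega⟩
    have hM := (moveClosed_initial_complement h₁₂ h₁₃ h₂₁ h₂₄ h₃₂ h₃₄ h₄₁ h₄₃ hle).iff_of_weight_eq
      hgen hw
    -- For this monomial and the next two, the partner uses variables of smaller weight, so equal
    -- weight forces larger degree.
    have hgood₁ : HasAxialReplacement n 0 a₁₂ a₁₃ 0 := by
      refine ⟨a₂₁ + a₄₁ - 1, 0, 0, 0, ?_, ?_⟩
      · rw [Nat.sub_add_cancel (by omega)]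
        exact e₁
      · simp only [expWeight] at e₁
        by_contra! hlt
        have : a₂₁ + a₄₁ ≤ a₁₂ + a₁₃ := by omega
        nlinarith
    have hgood₄ : HasAxialReplacement n 0 0 0 (a₂₄ + a₃₄) := by
      refine ⟨a₄₁ - 1, 0, a₄₃, 0, ?_, ?_⟩
      · rw [Nat.sub_add_cancel h₄₁]
        exact e₄.symm
      · simp only [expWeight] at e₄
        by_contra! hlt
        have : a₄₁ + a₄₃ ≤ a₂₄ + a₃₄ := by omega
        nlinarith
    have hgood₅ : HasAxialReplacement n 0 0 a₁₃ a₂₄ := by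
      refine ⟨a₄₁ - 1, a₃₂, 0, 0, ?_, ?_⟩
      · rw [Nat.sub_add_cancel h₄₁]
        exact e₅
      · simp only [expWeight] at e₅
        by_contra! hlt
        have : a₄₁ + a₃₂ ≤ a₁₃ + a₂₄ := by omega
        nlinarith
    by_cases c₂ : a₁₂ + a₃₂ ≤ y
    · exact hg₂.mono le_rfl c₂ (Nat.zero_le _) (Nat.zero_le _)
    by_cases c₄ : a₂₄ + a₃₄ ≤ t
    · exact hgood₄.mono le_rfl (Nat.zero_le _) (Nat.zero_le _) c₄
    by_cases c₃ : a₁₃ + a₄₃ + a₁₃ ≤ z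
    · exact hg₃.mono le_rfl (Nat.zero_le _) c₃ (Nat.zero_le _)
    by_cases c₁ : a₁₂ ≤ y ∧ a₁₃ ≤ z
    · exact hgood₁.mono le_rfl c₁.1 c₁.2 (Nat.zero_le _)
    by_cases c₅ : a₁₃ ≤ z ∧ a₂₄ ≤ t
    · exact hgood₅.mono le_rfl (Nat.zero_le _) c₅.1 c₅.2
    -- Now `(0, y, z, t)` lies in the closed set of `hM`, whose members have first exponent zero,
    -- unlike `x' + 1`.
    omega

lemma hasAxialReplacement_second_iff
    (h₁₂ : 0 < a₁₂) (h₁₃ : 0 < a₁₃) (h₂₁ : 0 < a₂₁) (h₂₄ : 0 < a₂₄) (h₃₂ : 0 < a₃₂)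
    (h₃₄ : 0 < a₃₄) (h₄₁ : 0 < a₄₁) (h₄₃ : 0 < a₄₃)
    (hgen : toricIdeal K n = Ideal.span (gorensteinBinomials K
      (a₂₁ + a₄₁) (a₁₂ + a₃₂) (a₁₃ + a₄₃) (a₂₄ + a₃₄) a₁₂ a₁₃ a₂₁ a₂₄ a₃₂ a₃₄ a₄₁ a₄₃)) :
    HasAxialReplacement n 0 (a₁₂ + a₃₂) 0 0 ↔ a₁₂ + a₃₂ ≤ a₂₁ + a₂₄ := by
  constructor
  · rintro ⟨x, y, z, t, hw, hd⟩
    have := (moveClosed_fiber_second h₁₂ h₁₃ h₂₁ h₂₄ h₃₂ h₃₄ h₄₁ h₄₃).iff_of_weight_eq hgen hw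
    omega
  · intro h
    refine ⟨a₂₁ - 1, 0, 0, a₂₄, ?_, by omega⟩
    rw [Nat.sub_add_cancel h₂₁]
    exact (expWeight_eq_of_generators hgen).2.1.symm

lemma hasAxialReplacement_third_iff
    (h₁₂ : 0 < a₁₂) (h₁₃ : 0 < a₁₃) (h₂₁ : 0 < a₂₁) (h₂₄ : 0 < a₂₄) (h₃₂ : 0 < a₃₂)
    (h₃₄ : 0 < a₃₄) (h₄₁ : 0 < a₄₁) (h₄₃ : 0 < a₄₃)
    (hgen : toricIdeal K n = Ideal.span (gorensteinBinomials K
      (a₂₁ + a₄₁) (a₁₂ + a₃₂) (a₁₃ + a₄₃) (a₂₄ + a₃₄) a₁₂ a₁₃ a₂₁ a₂₄ a₃₂ a₃₄ a₄₁ a₄₃))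
    (hle : a₂₄ ≤ a₃₄) (hsecond : a₁₂ + a₃₂ ≤ a₂₁ + a₂₄) :
    HasAxialReplacement n 0 0 (a₁₃ + a₄₃ + a₁₃) 0 ↔
      (a₃₂ < a₁₂ ∧ a₁₃ + a₄₃ + a₁₃ ≤ a₄₁ + 2 * a₃₂ + (a₃₄ - a₂₄)) ∨
      (a₁₂ ≤ a₃₂ ∧ a₁₃ + a₄₃ + a₁₃ ≤ a₂₁ + a₄₁ + (a₃₂ - a₁₂) + a₃₄) := by
  obtain ⟨e₁, e₂, e₃, e₄, e₅⟩ := expWeight_eq_of_generators hgen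
  constructor
  · rintro ⟨x, y, z, t, hw, hd⟩
    have := ((moveClosed_fiber_third h₁₂ h₁₃ h₂₁ h₂₄ h₃₂ h₃₄ h₄₁ h₄₃).iff_of_weight_eq hgen hw).2
      (Or.inl ⟨rfl, rfl, rfl, rfl⟩)
    rcases this with h | h | ⟨j, hx, hy, hz, ht⟩
    · omega
    · omega
    rcases lt_or_ge a₃₂ a₁₂ with hlt | hge
    · refine Or.inl ⟨hlt, ?_⟩
      -- Condition 1 makes the degree non-increasing in `j`, so the least admissible `j` decides:
      -- `1` here, since `j = 0` would need `a₁₂ ≤ a₃₂`, and `0` in the other case.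
      rcases j with _ | j
      · simp only [zero_mul] at hy
        omega
      · have := Nat.mul_le_mul_left j hsecond
        simp only [mul_add, add_mul, one_mul] at *
        omega
    · refine Or.inr ⟨hge, ?_⟩
      have := Nat.mul_le_mul_left j hsecond
      simp only [mul_add] at *
      omega
  · obtain ⟨c, rfl⟩ := exists_add_of_le hle
    rintro (⟨-, h⟩ | ⟨hge, h⟩)
    -- The member `j = 1` of the weight class; the other case uses `j = 0`.
    · refine ⟨a₄₁ - 1, 2 * a₃₂, 0, c, ?_, by omega⟩
      rw [Nat.sub_add_cancel h₄₁]
      simp only [expWeight] at e₃ e₅ ⊢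
      linarith
    · obtain ⟨b, rfl⟩ := exists_add_of_le hge
      refine ⟨a₂₁ + a₄₁ - 1, b, 0, a₂₄ + c, ?_, by omega⟩
      rw [Nat.sub_add_cancel (by omega)]
      simp only [expWeight] at e₁ e₃ ⊢
      linarith

end Gorenstein

end MonomialCurve

end

theorem mainTheorem6 {K : Type*} [Field K] (n : Fin 4 → ℕ)
    (hn_pos : 0 < n 0) (hn_lt : StrictMono n) (hn_gcd : Finset.univ.gcd n = 1)
    (a₁ a₂ a₃ a₄ a₁₂ a₁₃ a₂₁ a₂₄ a₃₂ a₃₄ a₄₁ a₄₃ : ℕ)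
    (h₁₂ : 0 < a₁₂ ∧ a₁₂ < a₂) (h₁₃ : 0 < a₁₃ ∧ a₁₃ < a₃)
    (h₂₁ : 0 < a₂₁ ∧ a₂₁ < a₁) (h₂₄ : 0 < a₂₄ ∧ a₂₄ < a₄)
    (h₃₂ : 0 < a₃₂ ∧ a₃₂ < a₂) (h₃₄ : 0 < a₃₄ ∧ a₃₄ < a₄)
    (h₄₁ : 0 < a₄₁ ∧ a₄₁ < a₁) (h₄₃ : 0 < a₄₃ ∧ a₄₃ < a₃)
    (hgen : MonomialCurve.toricIdeal K n =
      Ideal.span (MonomialCurve.gorensteinBinomials K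
        a₁ a₂ a₃ a₄ a₁₂ a₁₃ a₂₁ a₂₄ a₃₂ a₃₄ a₄₁ a₄₃))
    (hle : a₂₄ ≤ a₃₄) :
    MonomialCurve.HasCohenMacaulayTangentCone K n ↔
      a₂ ≤ a₂₁ + a₂₄ ∧
      ((a₃₂ < a₁₂ ∧ a₃ + a₁₃ ≤ a₄₁ + 2 * a₃₂ + (a₃₄ - a₂₄)) ∨
       (a₁₂ ≤ a₃₂ ∧ a₃ + a₁₃ ≤ a₁ + (a₃₂ - a₁₂) + a₃₄)) := by
  have hpos : ∀ i, 0 < n i := fun i => hn_pos.trans_le (hn_lt.monotone (Fin.zero_le i))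
  obtain ⟨rfl, rfl, rfl, rfl⟩ := MonomialCurve.exponent_relations h₁₂ h₁₃ h₂₁ h₂₄ h₃₂ h₃₄ h₄₁ h₄₃
    hpos hgen
  rw [MonomialCurve.hasCohenMacaulayTangentCone_iff hn_pos
      fun i hi => hn_lt (Fin.pos_iff_ne_zero.2 hi),
    MonomialCurve.forall_isMax_add_single_iff hpos,
    MonomialCurve.forall_hasAxialReplacement_iff hpos hn_lt h₁₂.1 h₁₃.1 h₂₁.1 h₂₄.1 h₃₂.1 h₃₄.1
      h₄₁.1 h₄₃.1 hgen hle,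
    MonomialCurve.hasAxialReplacement_second_iff h₁₂.1 h₁₃.1 h₂₁.1 h₂₄.1 h₃₂.1 h₃₄.1 h₄₁.1 h₄₃.1
      hgen]
  exact and_congr_right fun h => MonomialCurve.hasAxialReplacement_third_iff h₁₂.1 h₁₃.1 h₂₁.1
    h₂₄.1 h₃₂.1 h₃₄.1 h₄₁.1 h₄₃.1 hgen hle h
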